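/- **Theorem (integrality gap of Sherali–Adams on QSTAB).** A graph is $k$-claw-free if the neighborhood of no vertex contains an independent set of size $k$; $\alpha(G)$ denotes the independence number. For a graph $G$ on $[n]$ and $\ell\ge 1$, let $\mathsf{SA}_\ell(G)$ be the maximum of $\sum_{i\in[n]} y_{\{i\}}$ over all real vectors $(y_A)_{A\subseteq[n]}$ with $y_\emptyset=1$ such that, for all disjoint $S,T\subseteq[n]$ with $|S\cup T|\le \ell$, with $J_{S,T}(y):=\sum_{T'\subseteq T}(-1)^{|T'|}y_{S\cup T'}$, $$J_{S,T}(y)\ge \sum_{i\in Q}J_{S\cup\{i\},T}(y)\ \text{ for every clique } Q \text{ of } G,\qquad J_{S,T}(y)\ge 0,\qquad J_{S\cup\{i\},T}(y)\ge 0\ \text{ for every } i\in[n].$$ This is the $\ell$-round Sherali–Adams strengthening of the linear program $\max\{\sum_i x_i : x\in\mathsf{QSTAB}(G)\}$, where $\mathsf{QSTAB}(G)=\{x\in[0,1]^n:\sum_{i\in Q}x_i\le 1 \text{ for every clique } Q\}$. Its integrality gap is $\mathsf{SA}_\ell(G)/\alpha(G)$. There is an absolute constant $c_0>0$, and for every integer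 $k\ge 4$ there are constants $c_1,c_2>0$ depending only on $k$, such that the following holds for every real $\varepsilon$ with $0<\varepsilon\le 1/3$, where $\varepsilon<1/3$ if $k=4$. For infinitely many $n$ there is a connected $k$-claw-free graph $G_n$ on $n$ vertices with $\alpha(G_n)\ge c_0 n^{\varepsilon}$ such that for every integer $1\le \ell\le c_1 n^{1-2\varepsilon}$ the integrality gap of the $\ell$-round Sherali–Adams strengthening of $\mathsf{QSTAB}(G_n)$ is at least $c_2 n^{\varepsilon}$. -/

import Mathlib

open Finset

/-- The neighbourhood of no vertex contains an independent set of size `k`;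
equivalently `G` has no induced `K_{1,k}`. -/
def KClawFree {V : Type*} (G : SimpleGraph V) (k : ℕ) : Prop :=
  ∀ (v : V) (s : Finset V), (∀ u ∈ s, G.Adj v u) → ¬ G.IsNIndepSet k s

/-- The inclusion-exclusion expression `∑_{T' ⊆ T} (-1)^{|T'|} y_{S ∪ T'}`, the linearization of
`∏_{i ∈ S} x_i ∏_{j ∈ T} (1 - x_j)`. -/
def junta {V : Type*} [DecidableEq V] (y : Finset V → ℝ) (S T : Finset V) : ℝ :=
  ∑ T' ∈ T.powerset, (-1 : ℝ) ^ T'.card * y (S ∪ T')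

/-- Feasible solutions of the level-`ℓ` Sherali-Adams strengthening of `QSTAB(G)`, that is, of the
linear program `max ∑ x_i` subject to `x ≥ 0` and `∑_{i ∈ Q} x_i ≤ 1` for every clique `Q`. -/
structure SAFeasible {V : Type*} [DecidableEq V] (G : SimpleGraph V) (ℓ : ℕ)
    (y : Finset V → ℝ) : Prop where
  empty_eq_one : y ∅ = 1
  clique_constraint : ∀ S T : Finset V, Disjoint S T → (S ∪ T).card ≤ ℓ →
    ∀ Q : Finset V, G.IsClique (Q : Set V) → 0 ≤ junta y S T - ∑ i ∈ Q, junta y (insert i S) T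
  junta_nonneg : ∀ S T : Finset V, Disjoint S T → (S ∪ T).card ≤ ℓ → 0 ≤ junta y S T
  variable_nonneg : ∀ S T : Finset V, Disjoint S T → (S ∪ T).card ≤ ℓ →
    ∀ i : V, 0 ≤ junta y (insert i S) T

/-- The objective values attained by the level-`ℓ` program. -/
def saObjectives {V : Type*} [Fintype V] [DecidableEq V] (G : SimpleGraph V) (ℓ : ℕ) : Set ℝ :=
  {r | ∃ y : Finset V → ℝ, SAFeasible G ℓ y ∧ r = ∑ i : V, y {i}}

/-- The objective is bounded, so the supremum below is a genuine one. -/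
theorem saObjectives_bddAbove {V : Type*} [Fintype V] [DecidableEq V] (G : SimpleGraph V)
    (ℓ : ℕ) : BddAbove (saObjectives G ℓ) := by
  refine ⟨∑ _i : V, (1 : ℝ), ?_⟩
  rintro r ⟨y, hy, rfl⟩
  refine Finset.sum_le_sum fun i _ => ?_
  have h := hy.clique_constraint ∅ ∅ (by simp) (by simp) {i} (by simp)
  simp [junta, hy.empty_eq_one] at h
  exact h

/-- The program is feasible. -/
theorem saObjectives_nonempty {V : Type*} [Fintype V] [DecidableEq V] (G : SimpleGraph V)
    (ℓ : ℕ) : (saObjectives G ℓ).Nonempty := by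
  have h1 : ∀ S T : Finset V, 0 ≤ junta (fun A : Finset V => if A = ∅ then (1 : ℝ) else 0) S T := by
    intro S T
    refine Finset.sum_nonneg fun T' _ => ?_
    by_cases h : T' = ∅
    · subst h
      by_cases hS : S = ∅ <;> simp [hS]
    · simp [h]
  have h2 : ∀ (S T : Finset V) (i : V),
      junta (fun A : Finset V => if A = ∅ then (1 : ℝ) else 0) (insert i S) T = 0 := by
    intro S T i
    simp [junta]
  exact ⟨_, fun A => if A = ∅ then 1 else 0,
    ⟨by simp, fun S T _ _ Q _ => by simpa [h2] using h1 S T, fun S T _ _ => h1 S T,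
      fun S T _ _ i => (h2 S T i).ge⟩, rfl⟩

/-- The optimum of the level-`ℓ` program. -/
noncomputable def saValue {V : Type*} [Fintype V] [DecidableEq V] (G : SimpleGraph V)
    (ℓ : ℕ) : ℝ :=
  sSup (saObjectives G ℓ)

/-- The ratio between the optimum of the level-`ℓ` program and the independence number. -/
noncomputable def saIntegralityGap {V : Type*} [Fintype V] [DecidableEq V] (G : SimpleGraph V)
    (ℓ : ℕ) : ℝ :=
  saValue G ℓ / (G.indepNum : ℝ)

/-!
The Sherali–Adams lower bound comes from a single solution that ignores the graph apart from its
clique number: put `y_∅ = 1`, `y_{i} = p` and `y_A = 0` on all larger sets. Its juntas of level `ℓ`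
are `0`, `p` or `1 - p * |T|` with `|T| ≤ ℓ`, so it is feasible as soon as `p * (ℓ + ω) ≤ 1`, where
`ω` bounds the cliques of `G` (`saFeasible_singletonMoments`). The optimum is therefore at least
`n / (ℓ + ω)` (`card_div_le_saValue`), and for `ℓ` up to `n ^ (1 - 2 ε)` a gap of order `n ^ ε`
follows if `α(G)` has order `n ^ ε` and `ω` is `O(n ^ (1 - 2 ε))`. What remains is a Ramsey
question about connected claw-free graphs.

Such a graph is assembled from about `n ^ ε` copies of a block `B` on about `n ^ (1 - ε)` vertices.
Each copy receives an apex adjacent to all of it, and the apexes are joined to each other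
(`linkedCones`). This is connected, and if `α(B) ≤ s - 1` it is `(s + 1)`-claw-free, since a
neighbourhood is covered by one cone and one clique. The block must have no independent set of
size `s` and only cliques of size `O(|B| ^ γ)`, where `γ = (1 - 2 ε) / (1 - ε)`.
The Ramsey bound `R(s, t) ≥ t ^ ((s + 1) / 2 - o(1))` provides it when `γ > 2 / (s + 1)`
(`eventually_exists_graph`). The choice `s = 3` works for `ε < 1 / 3`, and `s = 4` for all
`ε ≤ 1 / 3`; the latter costs one more claw, which is the reason for the exception at `k = 4`.

The Ramsey bound is proved without the local lemma. In a random graph with edge probability `q`,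
having no independent `s`-set is an increasing event. Given a `t`-set `I`, the `s`-sets sharing at
most one vertex with `I` are independent of the pairs inside `I`, and Harris' inequality bounds
from below the conditional probability of avoiding the others. So, conditionally on there being
no independent `s`-set, `I` is a clique with probability at most
`q ^ (t choose 2)` divided by a product over the few `s`-sets that share a pair with `I`, and a
union bound over `I` finishes the argument (`exists_hits_of_lt`).
-/

open Finset

/-! ### A Sherali–Adams solution supported on singletons -/

theorem junta_subset_indicator {V : Type*} [DecidableEq V] (X S T : Finset V) :
    junta (fun A => if A ⊆ X then (1 : ℝ) else 0) S T = if S ⊆ X ∧ Disjoint T X then 1 else 0 := by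
  have h : junta (fun A => if A ⊆ X then (1 : ℝ) else 0) S T =
      if S ⊆ X then ∑ T' ∈ (T ∩ X).powerset, (-1 : ℝ) ^ T'.card else 0 := by
    unfold junta
    split_ifs with hS
    · simp only [union_subset_iff, hS, true_and, mul_ite, mul_one, mul_zero]
      rw [← sum_filter]
      refine sum_congr ?_ fun _ _ => rfl
      ext A
      rw [mem_filter, mem_powerset, mem_powerset, subset_inter_iff]
    · refine sum_eq_zero fun A _ => ?_
      simp [union_subset_iff, hS]
  rw [h]
  have h2 : ∑ T' ∈ (T ∩ X).powerset, (-1 : ℝ) ^ T'.card = if Disjoint T X then 1 else 0 := by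
    have := Finset.sum_powerset_neg_one_pow_card (x := T ∩ X)
    simp only [← disjoint_iff_inter_eq_empty] at this
    exact_mod_cast congrArg (Int.cast : ℤ → ℝ) this
  rw [h2]
  by_cases hS : S ⊆ X <;> simp [hS]

/-- The moment vector of the signed measure on subsets of `V` that gives mass `p` to every
singleton and the remaining mass `1 - p |V|` (possibly negative) to `∅`. -/
def singletonMoments {V : Type*} [Fintype V] [DecidableEq V] (p : ℝ) (A : Finset V) : ℝ :=
  (1 - p * Fintype.card V) * (if A ⊆ ∅ then 1 else 0) +
    p * ∑ i : V, if A ⊆ {i} then (1 : ℝ) else 0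

theorem singletonMoments_singleton {V : Type*} [Fintype V] [DecidableEq V] (p : ℝ) (i : V) :
    singletonMoments p {i} = p := by
  simp [singletonMoments]

theorem junta_singletonMoments {V : Type*} [Fintype V] [DecidableEq V] (p : ℝ)
    (S T : Finset V) :
    junta (singletonMoments p) S T = (1 - p * Fintype.card V) * (if S = ∅ then 1 else 0) +
      p * ∑ i : V, if S ⊆ {i} ∧ i ∉ T then (1 : ℝ) else 0 := by
  have h : junta (singletonMoments p) S T =
      (1 - p * Fintype.card V) * junta (fun A => if A ⊆ ∅ then (1 : ℝ) else 0) S T +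
      p * ∑ i : V, junta (fun A => if A ⊆ {i} then (1 : ℝ) else 0) S T := by
    unfold junta singletonMoments
    rw [mul_sum, sum_comm, mul_sum, ← sum_add_distrib]
    refine sum_congr rfl fun A _ => ?_
    rw [← mul_sum]
    ring
  rw [h]
  simp_rw [junta_subset_indicator]
  simp

theorem junta_singletonMoments_empty {V : Type*} [Fintype V] [DecidableEq V] (p : ℝ)
    (T : Finset V) : junta (singletonMoments p) ∅ T = 1 - p * T.card := by
  have h : (∑ i : V, if i ∉ T then (1 : ℝ) else 0) = Fintype.card V - T.card := by
    rw [← sum_filter, sum_const, nsmul_eq_mul, mul_one, filter_not, filter_mem_eq_inter,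
      univ_inter, ← compl_eq_univ_sdiff, card_compl, Nat.cast_sub (card_le_univ T)]
  rw [junta_singletonMoments]
  simp only [if_true, empty_subset, true_and, h]
  ring

theorem junta_singletonMoments_singleton {V : Type*} [Fintype V] [DecidableEq V] (p : ℝ)
    (j : V) (T : Finset V) :
    junta (singletonMoments p) {j} T = if j ∉ T then p else 0 := by
  rw [junta_singletonMoments]
  have h (i : V) : (if {j} ⊆ ({i} : Finset V) ∧ i ∉ T then (1 : ℝ) else 0) =
      if j = i then (if j ∉ T then 1 else 0) else 0 := by
    by_cases hij : j = i
    · subst hij; simp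
    · simp [hij]
  simp only [h, sum_ite_eq, mem_univ, if_true, if_neg (singleton_ne_empty j)]
  split_ifs <;> simp

theorem junta_singletonMoments_eq_zero {V : Type*} [Fintype V] [DecidableEq V] (p : ℝ)
    {S : Finset V} (hS : 1 < S.card) (T : Finset V) :
    junta (singletonMoments p) S T = 0 := by
  rw [junta_singletonMoments, if_neg (by rintro rfl; simp at hS)]
  have h (i : V) : ¬ S ⊆ {i} := fun h => by simpa using hS.trans_le (card_le_card h)
  simp [h]

/-- The signed measure need not be nonnegative: the juntas at level `ℓ` only see its values
`p` and `1 - p * |T|` with `|T| ≤ ℓ`, and a clique `Q` costs another `p * |Q|`. -/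
theorem saFeasible_singletonMoments {V : Type*} [Fintype V] [DecidableEq V] {G : SimpleGraph V}
    {ω ℓ : ℕ} (hω : ∀ Q : Finset V, G.IsClique (Q : Set V) → Q.card ≤ ω) {p : ℝ} (hp : 0 ≤ p)
    (hpℓ : p * (ℓ + ω) ≤ 1) : SAFeasible G ℓ (singletonMoments p) := by
  have key (T : Finset V) (hT : T.card ≤ ℓ) (c : ℕ) (hc : c ≤ ω) :
      0 ≤ 1 - p * T.card - c * p := by
    have h1 : (T.card : ℝ) ≤ ℓ := by exact_mod_cast hT
    have h2 : (c : ℝ) ≤ ω := by exact_mod_cast hc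
    nlinarith
  have hS (S T : Finset V) (h : S.card + T.card ≤ ℓ) : 0 ≤ junta (singletonMoments p) S T := by
    rcases lt_trichotomy S.card 1 with h1 | h1 | h1
    · obtain rfl : S = ∅ := by simpa using h1
      rw [junta_singletonMoments_empty]
      simpa using key T (by simpa using h) 0 (Nat.zero_le _)
    · obtain ⟨j, rfl⟩ := card_eq_one.1 h1
      rw [junta_singletonMoments_singleton]
      split_ifs <;> simp [hp]
    · exact (junta_singletonMoments_eq_zero p h1 T).ge
  have hi (S T : Finset V) (i : V) : 0 ≤ junta (singletonMoments p) (insert i S) T := by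
    rcases eq_or_ne (insert i S) {i} with h | h
    · rw [h, junta_singletonMoments_singleton]
      split_ifs <;> simp [hp]
    · refine (junta_singletonMoments_eq_zero p ?_ T).ge
      by_contra! h1
      exact h (eq_singleton_iff_unique_mem.2 ⟨mem_insert_self _ _, fun x hx =>
        card_le_one.1 h1 x hx i (mem_insert_self _ _)⟩)
  refine ⟨?_, fun S T hd hc Q hQ => ?_, fun S T hd hc => hS S T ?_, fun S T _ _ i => hi S T i⟩
  · simpa [junta] using junta_singletonMoments_empty p (∅ : Finset V)
  · rw [card_union_of_disjoint hd] at hc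
    rcases lt_trichotomy S.card 1 with h1 | h1 | h1
    · obtain rfl : S = ∅ := by simpa using h1
      have h2 : ∑ i ∈ Q, junta (singletonMoments p) (insert i ∅) T ≤ Q.card * p := by
        rw [← nsmul_eq_mul]
        refine sum_le_card_nsmul _ _ _ fun i _ => ?_
        rw [insert_empty_eq, junta_singletonMoments_singleton]
        split_ifs <;> simp [hp]
      rw [junta_singletonMoments_empty]
      linarith [key T (by simpa using hc) Q.card (hω Q hQ)]
    · obtain ⟨j, rfl⟩ := card_eq_one.1 h1
      have h2 (i : V) : junta (singletonMoments p) (insert i {j}) T =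
          if i = j then junta (singletonMoments p) {j} T else 0 := by
        split_ifs with h
        · subst h; simp
        · exact junta_singletonMoments_eq_zero p (by rw [card_pair h]; norm_num) T
      simp only [h2, sum_ite_eq']
      split_ifs
      · simp
      · simpa using hS {j} T hc
    · rw [junta_singletonMoments_eq_zero p h1, sum_eq_zero, sub_zero]
      exact fun i _ => junta_singletonMoments_eq_zero p
        (h1.trans_le (card_le_card (subset_insert i S))) T
  · rwa [card_union_of_disjoint hd] at hc

theorem card_div_le_saValue {V : Type*} [Fintype V] [DecidableEq V] {G : SimpleGraph V}
    {ω ℓ : ℕ} (hω : ∀ Q : Finset V, G.IsClique (Q : Set V) → Q.card ≤ ω) (hℓ : 1 ≤ ℓ) :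
    (Fintype.card V : ℝ) / (ℓ + ω) ≤ saValue G ℓ := by
  have hpos : (0 : ℝ) < ℓ + ω := by positivity
  refine le_csSup (saObjectives_bddAbove G ℓ) ⟨singletonMoments (1 / (ℓ + ω) : ℝ),
    saFeasible_singletonMoments hω (by positivity) (by field_simp; rfl), ?_⟩
  simp [singletonMoments_singleton, div_eq_mul_inv]

/-! ### Cones linked at their apexes -/

/-- The disjoint union of `m` copies of the cone over `B`, with the apexes `(i, none)` of the
cones made pairwise adjacent. -/
def linkedCones {V : Type*} (B : SimpleGraph V) (m : ℕ) : SimpleGraph (Fin m × Option V) where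
  Adj
    | (i, some a), (j, some b) => i = j ∧ B.Adj a b
    | (i, some _), (j, none) => i = j
    | (i, none), (j, some _) => i = j
    | (i, none), (j, none) => i ≠ j
  symm := ⟨by
    rintro ⟨i, _ | a⟩ ⟨j, _ | b⟩ h
    · exact Ne.symm h
    · exact Eq.symm h
    · exact Eq.symm h
    · exact ⟨h.1.symm, h.2.symm⟩⟩
  loopless := ⟨by
    rintro ⟨i, _ | a⟩ h
    · exact h rfl
    · exact B.irrefl h.2⟩

section
variable {V : Type*} {B : SimpleGraph V} {m : ℕ} {i j : Fin m} {a b : V}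

@[simp] theorem linkedCones_some_some :
    (linkedCones B m).Adj (i, some a) (j, some b) ↔ i = j ∧ B.Adj a b := Iff.rfl

@[simp] theorem linkedCones_some_none :
    (linkedCones B m).Adj (i, some a) (j, none) ↔ i = j := Iff.rfl

@[simp] theorem linkedCones_none_none :
    (linkedCones B m).Adj (i, none) (j, none) ↔ i ≠ j := Iff.rfl

theorem linkedCones_connected (B : SimpleGraph V) (hm : 0 < m) : (linkedCones B m).Connected := by
  have h0 (x : Fin m × Option V) : (linkedCones B m).Reachable x (x.1, none) := by
    rcases x with ⟨i, _ | a⟩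
    · exact SimpleGraph.Reachable.refl _
    · exact SimpleGraph.Adj.reachable (by simp)
  have h1 (i j : Fin m) : (linkedCones B m).Reachable (i, none) (j, none) := by
    rcases eq_or_ne i j with rfl | h
    · exact SimpleGraph.Reachable.refl _
    · exact SimpleGraph.Adj.reachable (by simpa using h)
  have : Nonempty (Fin m × Option V) := ⟨(⟨0, hm⟩, none)⟩
  exact ⟨fun x y => (h0 x).trans ((h1 _ _).trans (h0 y).symm)⟩

variable [DecidableEq V]

/-- An independent set meets each cone in an independent set of `B`, or in the apex alone. -/
theorem card_filter_fst_le_of_isIndepSet {α : ℕ} (hα : 1 ≤ α)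
    (hB : ∀ S : Finset V, B.IsIndepSet S → S.card ≤ α) {S : Finset (Fin m × Option V)}
    (hS : (linkedCones B m).IsIndepSet S) (i : Fin m) : (S.filter fun x => x.1 = i).card ≤ α := by
  by_cases h : (i, none) ∈ S
  · refine le_trans (card_le_one.2 ?_) hα
    suffices h1 : ∀ x ∈ S.filter (fun x => x.1 = i), x = (i, none) from
      fun x hx y hy => (h1 x hx).trans (h1 y hy).symm
    rintro ⟨j, x⟩ hx
    obtain ⟨hxS, rfl⟩ := mem_filter.1 hx
    by_contra hne
    refine hS hxS h hne ?_
    rcases x with _ | a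
    · exact absurd rfl hne
    · simp
  · have h1 : S.filter (fun x => x.1 = i) ⊆
        ((S.filter fun x => x.1 = i).image Prod.snd).eraseNone.image fun a => (i, some a) := by
      rintro ⟨j, x⟩ hx
      obtain ⟨hxS, rfl⟩ := mem_filter.1 hx
      rcases x with _ | a
      · exact absurd hxS h
      · exact mem_image_of_mem _ (mem_eraseNone.2 (mem_image_of_mem Prod.snd hx))
    refine (card_le_card h1).trans (card_image_le.trans (hB _ ?_))
    intro a ha b hb hab hadj
    simp only [mem_coe, mem_eraseNone, mem_image, mem_filter, Prod.exists] at ha hb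
    obtain ⟨_, _, ⟨ha, rfl⟩, rfl⟩ := ha
    obtain ⟨_, _, ⟨hb, rfl⟩, rfl⟩ := hb
    exact hS ha hb (by simpa using hab) (by simpa using hadj)

theorem card_le_of_isIndepSet_linkedCones {α : ℕ} (hα : 1 ≤ α)
    (hB : ∀ S : Finset V, B.IsIndepSet S → S.card ≤ α) {S : Finset (Fin m × Option V)}
    (hS : (linkedCones B m).IsIndepSet S) : S.card ≤ m * α := by
  rw [card_eq_sum_card_fiberwise (f := Prod.fst) (t := univ) fun _ _ => by simp]
  refine (sum_le_card_nsmul _ _ α fun i _ => card_filter_fst_le_of_isIndepSet hα hB hS i).trans ?_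
  simp

/-- Only an apex has neighbours in other cones, and those form a clique, so they add at most one
vertex to an independent set inside a neighbourhood. -/
theorem linkedCones_kClawFree {α : ℕ} (hα : 1 ≤ α)
    (hB : ∀ S : Finset V, B.IsIndepSet S → S.card ≤ α) : KClawFree (linkedCones B m) (α + 2) := by
  rintro ⟨i, v⟩ S hadj hS
  have h1 := card_filter_fst_le_of_isIndepSet hα hB hS.isIndepSet i
  have h2 : (S.filter fun x => ¬ x.1 = i).card ≤ 1 := by
    have h3 : ∀ x ∈ S.filter (fun x => ¬ x.1 = i), x.2 = none := by
      rintro ⟨j, x⟩ hx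
      obtain ⟨hx, hj⟩ := mem_filter.1 hx
      have := hadj _ hx
      rcases v with _ | v <;> rcases x with _ | x
      · rfl
      · exact absurd this.symm hj
      · rfl
      · exact absurd this.1.symm hj
    refine card_le_one.2 ?_
    rintro ⟨j, x⟩ hx ⟨j', x'⟩ hx'
    obtain rfl : x = none := h3 _ hx
    obtain rfl : x' = none := h3 _ hx'
    by_contra hne
    exact hS.isIndepSet (mem_filter.1 hx).1 (mem_filter.1 hx').1 hne
      (linkedCones_none_none.2 fun h => hne (by rw [h]))
  have h3 := card_filter_add_card_filter_not (s := S) fun x => x.1 = i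
  have h4 := hS.card_eq
  omega

theorem card_le_of_isClique_linkedCones {ω : ℕ}
    (hB : ∀ S : Finset V, B.IsClique S → S.card ≤ ω) {Q : Finset (Fin m × Option V)}
    (hQ : (linkedCones B m).IsClique Q) : Q.card ≤ max (ω + 1) m := by
  by_cases h : ∀ x ∈ Q, x.2 = none
  · refine le_max_of_le_right ?_
    have := card_le_card_of_injOn (s := Q) (t := univ) Prod.fst (fun _ _ => by simp)
      fun x hx y hy hxy =>
      Prod.ext hxy ((h x hx).trans (h y hy).symm)
    simpa using this
  · refine le_max_of_le_left ?_
    push Not at h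
    obtain ⟨⟨i, x⟩, hx, hne⟩ := h
    obtain ⟨v, rfl⟩ := Option.ne_none_iff_exists'.1 hne
    have hi : ∀ y ∈ Q, y.1 = i := by
      rintro ⟨j, y⟩ hy
      by_contra hj
      have hadj := hQ hx hy fun h => hj (congrArg Prod.fst h).symm
      rcases y with _ | y
      · exact hj (linkedCones_some_none.1 hadj).symm
      · exact hj (linkedCones_some_some.1 hadj).1.symm
    have h1 : Q ⊆ insert (i, none) ((Q.image Prod.snd).eraseNone.image fun a => (i, some a)) := by
      rintro ⟨j, y⟩ hy
      obtain rfl : j = i := hi _ hy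
      rcases y with _ | a
      · exact mem_insert_self _ _
      · exact mem_insert_of_mem 
          (mem_image_of_mem _ (mem_eraseNone.2 (mem_image_of_mem Prod.snd hy)))
    refine (card_le_card h1).trans ((card_insert_le _ _).trans
      (Nat.succ_le_succ (card_image_le.trans (hB _ ?_))))
    intro a ha b hb hab
    simp only [mem_coe, mem_eraseNone, mem_image, Prod.exists] at ha hb
    obtain ⟨j, _, ha, rfl⟩ := ha
    obtain ⟨j', _, hb, rfl⟩ := hb
    have := hQ ha hb (by simpa using fun _ => hab)
    simpa using (linkedCones_some_some.1 this).2

theorem le_indepNum_linkedCones [Finite V] [Nonempty V] (B : SimpleGraph V) (m : ℕ) :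
    m ≤ (linkedCones B m).indepNum := by
  obtain ⟨v⟩ := ‹Nonempty V›
  have h : (linkedCones B m).IsIndepSet
      ((univ : Finset (Fin m)).image fun i => (i, some v) : Finset (Fin m × Option V)) := by
    intro x hx y hy hne hadj
    simp only [coe_image, coe_univ, Set.image_univ, Set.mem_range] at hx hy
    obtain ⟨i, rfl⟩ := hx
    obtain ⟨j, rfl⟩ := hy
    exact B.irrefl (linkedCones_some_some.1 hadj).2
  have := h.card_le_indepNum
  rwa [card_image_of_injective _ fun i j h => congrArg Prod.fst h, card_univ,
    Fintype.card_fin] at this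

end

/-- The conditions on a graph that bound its integrality gap below, on an arbitrary vertex type,
are transported to `Fin n`. -/
theorem exists_fin_graph {W : Type*} [Fintype W] [DecidableEq W] (H : SimpleGraph W) {k ω n : ℕ}
    (hn : Fintype.card W = n) (hconn : H.Connected) (hclaw : KClawFree H k)
    (hω : ∀ Q : Finset W, H.IsClique (Q : Set W) → Q.card ≤ ω) :
    ∃ G : SimpleGraph (Fin n), G.Connected ∧ KClawFree G k ∧ G.indepNum = H.indepNum ∧
      ∀ Q : Finset (Fin n), G.IsClique (Q : Set (Fin n)) → Q.card ≤ ω := by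
  let e := Fintype.equivFinOfCardEq hn
  let G := H.map e.toEmbedding
  let φ : H ≃g G := SimpleGraph.Iso.map e H
  have key (S : Finset (Fin n)) (j : ℕ) :
      G.IsNIndepSet j S → H.IsNIndepSet j (S.map φ.symm.toEquiv.toEmbedding) := by
    intro h
    refine ⟨?_, by rw [card_map, h.card_eq]⟩
    intro x hx y hy hne hadj
    simp only [coe_map, Set.mem_image, mem_coe] at hx hy
    obtain ⟨x, hx, rfl⟩ := hx
    obtain ⟨y, hy, rfl⟩ := hy
    exact h.isIndepSet hx hy (fun h => hne (by rw [h])) (φ.symm.map_adj_iff.1 hadj)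
  refine ⟨G, φ.connected_iff.1 hconn, ?_, ?_, ?_⟩
  · intro v S hS hI
    refine hclaw (φ.symm v) _ ?_ (key S k hI)
    intro u hu
    obtain ⟨w, hw, rfl⟩ := mem_map.1 hu
    exact φ.symm.map_adj_iff.2 (hS w hw)
  · apply le_antisymm
    · obtain ⟨S, hS⟩ := G.exists_isNIndepSet_indepNum
      have h := key S _ hS
      exact h.card_eq ▸ h.isIndepSet.card_le_indepNum
    · obtain ⟨S, hS⟩ := H.exists_isNIndepSet_indepNum
      have h : G.IsIndepSet (S.map φ.toEquiv.toEmbedding : Finset _) := by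
        intro x hx y hy hne hadj
        simp only [coe_map, Set.mem_image, mem_coe] at hx hy
        obtain ⟨x, hx, rfl⟩ := hx
        obtain ⟨y, hy, rfl⟩ := hy
        exact hS.isIndepSet hx hy (fun h => hne (by rw [h])) (φ.map_adj_iff.1 hadj)
      have := h.card_le_indepNum
      rwa [card_map, hS.card_eq] at this
  · intro Q hQ
    rw [← card_map φ.symm.toEquiv.toEmbedding]
    apply hω
    intro x hx y hy hne
    simp only [coe_map, Set.mem_image, mem_coe] at hx hy
    obtain ⟨x, hx, rfl⟩ := hx
    obtain ⟨y, hy, rfl⟩ := hy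
    exact φ.symm.map_adj_iff.2 (hQ hx hy fun h => hne (by rw [h]))

/-! ### Harris' inequality and random graphs -/

/-- The probability that a random subset of `ι`, containing each element independently with
probability `q`, equals `X`. -/
noncomputable def bernoulliWeight {ι : Type*} [Fintype ι] [DecidableEq ι] (q : ℝ)
    (X : Finset ι) : ℝ :=
  q ^ X.card * (1 - q) ^ (Xᶜ).card

/-- The expectation of `f` at a random subset of `ι` that contains each element independently
with probability `q`. -/
noncomputable def bernoulliExp {ι : Type*} [Fintype ι] [DecidableEq ι] (q : ℝ)
    (f : Finset ι → ℝ) : ℝ :=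
  ∑ X, bernoulliWeight q X * f X

/-- The indicator function of the event that the random set meets `K`. -/
noncomputable def hits {ι : Type*} [DecidableEq ι] (K X : Finset ι) : ℝ :=
  if Disjoint K X then 0 else 1

theorem hits_nonneg {ι : Type*} [DecidableEq ι] (K : Finset ι) : 0 ≤ hits K := by
  intro X
  unfold hits
  split_ifs <;> simp

theorem hits_monotone {ι : Type*} [DecidableEq ι] (K : Finset ι) : Monotone (hits K) := by
  intro X Y h
  by_cases hY : Disjoint K Y
  · simp [hits, hY, hY.mono_right h]
  · simp only [hits, hY, if_false]
    split_ifs <;> simp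

theorem prod_hits_nonneg {ι κ : Type*} [DecidableEq ι] (s : Finset κ) (K : κ → Finset ι) :
    0 ≤ fun X => ∏ S ∈ s, hits (K S) X :=
  fun X => prod_nonneg fun S _ => hits_nonneg (K S) X

theorem prod_hits_monotone {ι κ : Type*} [DecidableEq ι] (s : Finset κ) (K : κ → Finset ι) :
    Monotone fun X => ∏ S ∈ s, hits (K S) X :=
  fun _ _ h => prod_le_prod (fun S _ => hits_nonneg (K S) _) fun S _ => hits_monotone (K S) h

section
variable {ι κ : Type*} [Fintype ι] [DecidableEq ι] {q : ℝ}

theorem bernoulliWeight_nonneg (h0 : 0 ≤ q) (h1 : q ≤ 1) (X : Finset ι) :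
    0 ≤ bernoulliWeight q X :=
  mul_nonneg (pow_nonneg h0 _) (pow_nonneg (sub_nonneg.2 h1) _)

theorem bernoulliExp_one : bernoulliExp q (fun _ : Finset ι => 1) = 1 := by
  have h := Fintype.sum_pow_mul_eq_add_pow ι q (1 - q)
  simp only [add_sub_cancel, one_pow] at h
  simpa [bernoulliExp, bernoulliWeight, card_compl] using h

theorem bernoulliExp_mono (h0 : 0 ≤ q) (h1 : q ≤ 1) {f g : Finset ι → ℝ} (h : ∀ X, f X ≤ g X) :
    bernoulliExp q f ≤ bernoulliExp q g :=
  sum_le_sum fun X _ => mul_le_mul_of_nonneg_left (h X) (bernoulliWeight_nonneg h0 h1 X)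

theorem bernoulliExp_sum (s : Finset κ) (f : κ → Finset ι → ℝ) :
    bernoulliExp q (fun X => ∑ i ∈ s, f i X) = ∑ i ∈ s, bernoulliExp q (f i) := by
  simp only [bernoulliExp, mul_sum]
  exact sum_comm

/-- Harris' inequality. -/
theorem bernoulliExp_mul_le (h0 : 0 ≤ q) (h1 : q ≤ 1) {f g : Finset ι → ℝ} (hf0 : 0 ≤ f)
    (hg0 : 0 ≤ g) (hf : Monotone f) (hg : Monotone g) :
    bernoulliExp q f * bernoulliExp q g ≤ bernoulliExp q (fun X => f X * g X) := by
  have h := fkg (α := Finset ι) (μ := bernoulliWeight q) f g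
    (bernoulliWeight_nonneg h0 h1) hf0 hg0 hf hg fun X Y => by
      have e1 := card_union_add_card_inter X Y
      have e2 := card_union_add_card_inter Xᶜ Yᶜ
      rw [← compl_inter, ← compl_union] at e2
      apply le_of_eq
      simp only [bernoulliWeight, inf_eq_inter, sup_eq_union]
      calc _ = q ^ (X.card + Y.card) * (1 - q) ^ (Xᶜ.card + Yᶜ.card) := by ring
        _ = _ := by rw [← e1, ← e2]; ring
  have h' := bernoulliExp_one (ι := ι) (q := q)
  simp only [bernoulliExp, mul_one] at h'
  rwa [h', one_mul] at h

theorem bernoulliWeight_insert (q : ℝ) {e : ι} {X : Finset ι} (he : e ∉ X) :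
    (1 - q) * bernoulliWeight q (insert e X) = q * bernoulliWeight q X := by
  have h : (Xᶜ).card = ((insert e X)ᶜ).card + 1 := by
    rw [compl_insert, card_erase_add_one (by simpa using he)]
  rw [bernoulliWeight, bernoulliWeight, card_insert_of_notMem he, h]
  ring

theorem bernoulliExp_eq_sum_notMem (f : Finset ι → ℝ) (e : ι) :
    bernoulliExp q f = ∑ X with e ∉ X, (bernoulliWeight q X * f X +
      bernoulliWeight q (insert e X) * f (insert e X)) := by
  rw [bernoulliExp, ← sum_filter_add_sum_filter_not univ (fun X : Finset ι => e ∉ X),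
    sum_add_distrib]
  congr 1
  refine sum_bij' (fun X _ => X.erase e) (fun X _ => insert e X) ?_ ?_ ?_ ?_ ?_
  · simp
  · simp
  · intro X hX; exact insert_erase (by simpa using hX)
  · intro X hX; exact erase_insert (by simpa using hX)
  · intro X hX
    rw [insert_erase (by simpa using hX)]

/-- The event of containing `I` is independent of every function that does not depend on `I`. -/
theorem bernoulliExp_subset_mul (I : Finset ι) (f : Finset ι → ℝ)
    (hf : ∀ e ∈ I, ∀ X, f (insert e X) = f X) :
    bernoulliExp q (fun X => (if I ⊆ X then 1 else 0) * f X) =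
      q ^ I.card * bernoulliExp q f := by
  induction I using Finset.induction_on with
  | empty => simp
  | insert e I he ih =>
    have ih := ih fun e' he' => hf e' (mem_insert_of_mem he')
    rw [card_insert_of_notMem he, pow_succ', mul_assoc, ← ih, bernoulliExp_eq_sum_notMem _ e,
      bernoulliExp_eq_sum_notMem _ e, mul_sum]
    refine sum_congr rfl fun X hX => ?_
    have hX : e ∉ X := by simpa using hX
    have hw := bernoulliWeight_insert q hX
    have h1 : ¬ insert e I ⊆ X := fun h => hX (h (mem_insert_self _ _))
    have h2 : insert e I ⊆ insert e X ↔ I ⊆ X := by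
      rw [insert_subset_insert_iff he]
    have h3 : I ⊆ insert e X ↔ I ⊆ X := by
      rw [subset_insert_iff_of_notMem he]
    simp only [h1, h2, h3, if_false, hf e (mem_insert_self _ _) X]
    linear_combination (if I ⊆ X then (1 : ℝ) else 0) * f X * hw

theorem bernoulliExp_hits (K : Finset ι) :
    bernoulliExp q (hits K) = 1 - (1 - q) ^ K.card := by
  have h : bernoulliExp q (fun X => if Disjoint K X then 1 else 0) = (1 - q) ^ K.card := by
    have h1 := bernoulliExp_subset_mul (q := 1 - q) K (fun _ => 1) fun _ _ _ => rfl
    rw [bernoulliExp_one, mul_one] at h1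
    rw [← h1, bernoulliExp, bernoulliExp]
    refine Fintype.sum_equiv (Equiv.ofBijective _ compl_bijective) _ _ fun X => ?_
    simp only [Equiv.ofBijective_apply, bernoulliWeight, compl_compl, sub_sub_cancel, mul_one,
      subset_compl_iff_disjoint_right]
    ring
  rw [← h, eq_sub_iff_add_eq]
  refine Eq.trans ?_ (bernoulliExp_one (ι := ι) (q := q))
  simp only [bernoulliExp, ← sum_add_distrib]
  refine sum_congr rfl fun X _ => ?_
  by_cases h : Disjoint K X <;> simp [hits, h]

theorem le_bernoulliExp_prod_hits (h0 : 0 ≤ q) (h1 : q ≤ 1) (s : Finset κ) (K : κ → Finset ι)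
    {c : ℕ} (hc : ∀ S ∈ s, (K S).card = c) :
    (1 - (1 - q) ^ c) ^ s.card ≤ bernoulliExp q (fun X => ∏ S ∈ s, hits (K S) X) := by
  classical
  induction s using Finset.induction_on with
  | empty => simp [bernoulliExp_one]
  | insert S s hS ih =>
    have h2 : 0 ≤ 1 - (1 - q) ^ c := by
      linarith [pow_le_one₀ (n := c) (sub_nonneg.2 h1) (by linarith : 1 - q ≤ 1)]
    simp only [prod_insert hS]
    refine le_trans ?_ (bernoulliExp_mul_le h0 h1 (hits_nonneg _) (prod_hits_nonneg s K)
      (hits_monotone _) (prod_hits_monotone s K))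
    rw [card_insert_of_notMem hS, pow_succ', bernoulliExp_hits, hc S (mem_insert_self _ _)]
    exact mul_le_mul_of_nonneg_left (ih fun T hT => hc T (mem_insert_of_mem hT)) h2

/-- Conditioning on the event of meeting every `K S`, which is increasing, multiplies the
probability `q ^ b` of containing a given `I` by a factor of at most `(1 - (1 - q) ^ c) ^ (-M)`:
those `K S` that are disjoint from `I` play no role, and by Harris' inequality the others
are all met with conditional probability at least `(1 - (1 - q) ^ c) ^ M`. -/
theorem exists_hits_of_lt (h0 : 0 < q) (h1 : q < 1) (s : Finset κ) (K : κ → Finset ι)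
    {c b M : ℕ} (hc0 : c ≠ 0) (hc : ∀ S ∈ s, (K S).card = c) (ℬ : Finset (Finset ι))
    (hb : ∀ I ∈ ℬ, I.card = b)
    (hM : ∀ I ∈ ℬ, (s.filter fun S => ¬ Disjoint (K S) I).card ≤ M)
    (hlt : ℬ.card * q ^ b < (1 - (1 - q) ^ c) ^ M) :
    ∃ X : Finset ι, (∀ S ∈ s, ¬ Disjoint (K S) X) ∧ ∀ I ∈ ℬ, ¬ I ⊆ X := by
  by_contra! hcon
  set δ : ℝ := 1 - (1 - q) ^ c with hδ
  have hδ0 : 0 < δ := sub_pos.2 (pow_lt_one₀ (by linarith) (by linarith) hc0)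
  have hδ1 : δ ≤ 1 := by linarith [pow_nonneg (sub_nonneg.2 h1.le) c]
  set D := bernoulliExp q (fun X => ∏ S ∈ s, hits (K S) X) with hD
  have hD0 : 0 < D := (pow_pos hδ0 _).trans_le (le_bernoulliExp_prod_hits h0.le h1.le s K hc)
  have hI : ∀ I ∈ ℬ, δ ^ M * bernoulliExp q (fun X => (if I ⊆ X then 1 else 0) *
      ∏ S ∈ s, hits (K S) X) ≤ q ^ b * D := by
    intro I hI
    set s₁ := s.filter fun S => ¬ Disjoint (K S) I
    set s₂ := s.filter fun S => Disjoint (K S) I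
    have hsplit (X : Finset ι) : ∏ S ∈ s, hits (K S) X =
        (∏ S ∈ s₂, hits (K S) X) * ∏ S ∈ s₁, hits (K S) X :=
      (prod_filter_mul_prod_filter_not s _ _).symm
    have hle1 (X : Finset ι) : ∏ S ∈ s₁, hits (K S) X ≤ 1 :=
      prod_le_one (fun S _ => hits_nonneg (K S) X) fun S _ => by
        unfold hits; split_ifs <;> simp
    have ha : bernoulliExp q (fun X => (if I ⊆ X then 1 else 0) * ∏ S ∈ s, hits (K S) X) ≤
        q ^ b * bernoulliExp q (fun X => ∏ S ∈ s₂, hits (K S) X) := by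
      rw [← hb I hI, ← bernoulliExp_subset_mul]
      · refine bernoulliExp_mono h0.le h1.le fun X => ?_
        refine mul_le_mul_of_nonneg_left ?_ (by split_ifs <;> simp)
        rw [hsplit]
        exact mul_le_of_le_one_right (prod_hits_nonneg s₂ K X) (hle1 X)
      · intro e he X
        refine prod_congr rfl fun S hS => ?_
        have : e ∉ K S := fun h => disjoint_left.1 (mem_filter.1 hS).2 h he
        simp [hits, disjoint_insert_right, this]
    have hb' : bernoulliExp q (fun X => ∏ S ∈ s₂, hits (K S) X) * δ ^ M ≤ D := by
      refine le_trans ?_ ((bernoulliExp_mul_le h0.le h1.le (prod_hits_nonneg s₂ K)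
        (prod_hits_nonneg s₁ K) (prod_hits_monotone s₂ K) (prod_hits_monotone s₁ K)).trans_eq ?_)
      · refine mul_le_mul_of_nonneg_left ?_ (sum_nonneg fun X _ =>
          mul_nonneg (bernoulliWeight_nonneg h0.le h1.le X) (prod_hits_nonneg s₂ K X))
        exact (pow_le_pow_of_le_one hδ0.le hδ1 (hM I hI)).trans
          (le_bernoulliExp_prod_hits h0.le h1.le s₁ K fun S hS => hc S (mem_filter.1 hS).1)
      · simp only [hD, hsplit]
    calc _ ≤ δ ^ M * (q ^ b * bernoulliExp q (fun X => ∏ S ∈ s₂, hits (K S) X)) :=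
          mul_le_mul_of_nonneg_left ha (pow_nonneg hδ0.le _)
      _ = q ^ b * (bernoulliExp q (fun X => ∏ S ∈ s₂, hits (K S) X) * δ ^ M) := by ring
      _ ≤ q ^ b * D := mul_le_mul_of_nonneg_left hb' (pow_nonneg h0.le _)
  have hcover : D ≤ ∑ I ∈ ℬ, bernoulliExp q (fun X => (if I ⊆ X then 1 else 0) *
      ∏ S ∈ s, hits (K S) X) := by
    rw [← bernoulliExp_sum]
    refine bernoulliExp_mono h0.le h1.le fun X => ?_
    rw [← sum_mul]
    by_cases hX : ∀ S ∈ s, ¬ Disjoint (K S) X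
    · obtain ⟨I, hIℬ, hIX⟩ := hcon X hX
      refine le_mul_of_one_le_left (prod_hits_nonneg s K X) ?_
      have := single_le_sum (f := fun I => if I ⊆ X then (1 : ℝ) else 0)
        (fun J _ => by split_ifs <;> simp) hIℬ
      simpa [hIX] using this
    · push Not at hX
      obtain ⟨S, hS, hSX⟩ := hX
      rw [prod_eq_zero hS (by simp [hits, hSX]), mul_zero]
  have hfin : δ ^ M * D ≤ ℬ.card * q ^ b * D := by
    refine (mul_le_mul_of_nonneg_left hcover (pow_nonneg hδ0.le _)).trans ?_
    rw [mul_sum, mul_assoc, ← nsmul_eq_mul]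
    exact sum_le_card_nsmul _ _ _ hI
  exact hfin.not_gt (mul_lt_mul_of_pos_right hlt hD0)

end

/-- The set of all pairs of distinct elements of `S`: the edges of the complete graph on `S`. -/
def pairsIn {V : Type*} [DecidableEq V] (S : Finset V) : Finset (Sym2 V) :=
  S.offDiag.image fun a => s(a.1, a.2)

theorem mem_pairsIn {V : Type*} [DecidableEq V] {S : Finset V} {a b : V} :
    s(a, b) ∈ pairsIn S ↔ a ∈ S ∧ b ∈ S ∧ a ≠ b := by
  simp only [pairsIn, mem_image, mem_offDiag, Prod.exists, Sym2.eq_iff]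
  constructor
  · rintro ⟨x, y, ⟨hx, hy, h⟩, ⟨rfl, rfl⟩ | ⟨rfl, rfl⟩⟩
    exacts [⟨hx, hy, h⟩, ⟨hy, hx, h.symm⟩]
  · exact fun h => ⟨a, b, h, Or.inl ⟨rfl, rfl⟩⟩

theorem card_pairsIn {V : Type*} [DecidableEq V] (S : Finset V) :
    (pairsIn S).card = S.card.choose 2 :=
  Sym2.card_image_offDiag S

theorem card_filter_not_disjoint_pairsIn_le {V : Type*} [Fintype V] [DecidableEq V]
    (s : ℕ) (I : Finset V) :
    ((powersetCard s (univ : Finset V)).filter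
      fun S => ¬ Disjoint (pairsIn S) (pairsIn I)).card ≤
        I.card.choose 2 * (Fintype.card V) ^ (s - 2) := by
  have hsub : (powersetCard s (univ : Finset V)).filter
      (fun S => ¬ Disjoint (pairsIn S) (pairsIn I)) ⊆
      (powersetCard 2 I ×ˢ powersetCard (s - 2) univ).image fun P => P.1 ∪ P.2 := by
    intro S hS
    obtain ⟨hS, hne⟩ := mem_filter.1 hS
    obtain ⟨e, he1, he2⟩ := not_disjoint_iff.1 hne
    induction e with
    | _ a b =>
      rw [mem_pairsIn] at he1 he2
      have hab : ({a, b} : Finset V) ⊆ S := by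
        simp [insert_subset_iff, he1.1, he1.2.1]
      refine mem_image.2 ⟨({a, b}, S \ {a, b}), ?_, union_sdiff_of_subset hab⟩
      simp only [mem_product, mem_powersetCard]
      refine ⟨⟨by simp [insert_subset_iff, he2.1, he2.2.1], card_pair he1.2.2⟩, subset_univ _, ?_⟩
      rw [card_sdiff_of_subset hab, card_pair he1.2.2, (mem_powersetCard.1 hS).2]
  refine (card_le_card hsub).trans (card_image_le.trans ?_)
  rw [card_product, card_powersetCard, card_powersetCard, card_univ]
  exact Nat.mul_le_mul_left _ (Nat.choose_le_pow _ _)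

/-- The union bound over `t`-sets, after conditioning on the absence of independent `s`-sets. -/
theorem exists_graph_of_lt {V : Type*} [Fintype V] [DecidableEq V] {s t : ℕ}
    (hs : 2 ≤ s) {p : ℝ} (hp0 : 0 < p) (hp1 : p < 1)
    (hlt : (Fintype.card V : ℝ) ^ t * (1 - p) ^ (t.choose 2) <
      (1 - p ^ (s.choose 2)) ^ (t.choose 2 * Fintype.card V ^ (s - 2))) :
    ∃ B : SimpleGraph V, (∀ S, ¬ B.IsNIndepSet s S) ∧ ∀ S, ¬ B.IsNClique t S := by
  obtain ⟨X, hX1, hX2⟩ := exists_hits_of_lt (ι := Sym2 V) (q := 1 - p) (by linarith) (by linarith)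
    (powersetCard s univ) pairsIn (c := s.choose 2) (b := t.choose 2)
    (M := t.choose 2 * Fintype.card V ^ (s - 2)) (Nat.choose_pos hs).ne'
    (fun S hS => by rw [card_pairsIn, (mem_powersetCard.1 hS).2])
    ((powersetCard t (univ : Finset V)).image pairsIn)
    (fun I hI => by
      obtain ⟨S, hS, rfl⟩ := mem_image.1 hI
      rw [card_pairsIn, (mem_powersetCard.1 hS).2])
    (fun I hI => by
      obtain ⟨S, hS, rfl⟩ := mem_image.1 hI
      rw [← (mem_powersetCard.1 hS).2]
      exact card_filter_not_disjoint_pairsIn_le s S)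
    (by
      rw [sub_sub_cancel]
      refine lt_of_le_of_lt ?_ hlt
      refine mul_le_mul_of_nonneg_right ?_ (pow_nonneg (by linarith) _)
      have : ((powersetCard t (univ : Finset V)).image pairsIn).card ≤ Fintype.card V ^ t := by
        refine card_image_le.trans ?_
        rw [card_powersetCard, card_univ]
        exact Nat.choose_le_pow _ _
      exact_mod_cast this)
  refine ⟨SimpleGraph.fromEdgeSet (X : Set (Sym2 V)), fun S hS => ?_, fun S hS => ?_⟩
  · refine hX1 S (mem_powersetCard.2 ⟨subset_univ _, hS.card_eq⟩) (disjoint_left.2 ?_)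
    intro e he heX
    induction e with
    | _ a b =>
      obtain ⟨ha, hb, hab⟩ := mem_pairsIn.1 he
      exact hS.isIndepSet ha hb hab ((SimpleGraph.fromEdgeSet_adj _).2 ⟨heX, hab⟩)
  · refine hX2 _ (mem_image_of_mem _ (mem_powersetCard.2 ⟨subset_univ _, hS.card_eq⟩)) ?_
    intro e he
    induction e with
    | _ a b =>
      obtain ⟨ha, hb, hab⟩ := mem_pairsIn.1 he
      exact ((SimpleGraph.fromEdgeSet_adj _).1 (hS.isClique ha hb hab)).1

/-! ### Ramsey bound and choice of parameters -/

theorem exp_neg_two_mul_le_one_sub {x : ℝ} (h0 : 0 ≤ x) (h1 : x ≤ 1 / 2) :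
    Real.exp (-(2 * x)) ≤ 1 - x := by
  rw [Real.exp_neg]
  refine inv_le_of_inv_le₀ (by linarith) ?_
  refine le_trans ?_ (Real.add_one_le_exp (2 * x))
  rw [inv_le_iff_one_le_mul₀ (by linarith)]
  nlinarith

theorem pow_mul_one_sub_pow_lt {n s t : ℕ} {p : ℝ} (hn : 0 < n) (hs : 3 ≤ s) (ht : 2 ≤ t)
    (hp0 : 0 < p) (hp1 : p ≤ 1 / 2)
    (hA : 4 * (n : ℝ) ^ (s - 2) * p ^ (s.choose 2 - 1) ≤ 1)
    (hB : 4 * Real.log n < p * (t - 1)) :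
    (n : ℝ) ^ t * (1 - p) ^ (t.choose 2) <
      (1 - p ^ (s.choose 2)) ^ (t.choose 2 * n ^ (s - 2)) := by
  have hn' : (0 : ℝ) < n := by exact_mod_cast hn
  have hc : s.choose 2 ≠ 0 := (Nat.choose_pos (by omega)).ne'
  have ht' : (2 : ℝ) ≤ t := by exact_mod_cast ht
  have hb : ((t.choose 2 : ℕ) : ℝ) = t * (t - 1) / 2 := Nat.cast_choose_two ℝ t
  have hb0 : (0 : ℝ) ≤ (t.choose 2 : ℕ) := Nat.cast_nonneg _
  have hpc : p ^ s.choose 2 ≤ 1 / 2 := (pow_le_of_le_one hp0.le (by linarith) hc).trans hp1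
  calc (n : ℝ) ^ t * (1 - p) ^ (t.choose 2)
      ≤ Real.exp (t * Real.log n) * Real.exp (t.choose 2 * -p) := by
        rw [Real.exp_nat_mul, Real.exp_log hn', Real.exp_nat_mul]
        gcongr
        · linarith
        · linarith [Real.add_one_le_exp (-p)]
    _ = Real.exp (t * Real.log n - t.choose 2 * p) := by rw [← Real.exp_add]; ring_nf
    _ < Real.exp ((t.choose 2 * n ^ (s - 2) : ℕ) * -(2 * p ^ s.choose 2)) := by
        apply Real.exp_lt_exp.2
        have h1 : (t.choose 2 : ℝ) * p * (4 * (n : ℝ) ^ (s - 2) * p ^ (s.choose 2 - 1)) ≤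
            t.choose 2 * p * 1 := mul_le_mul_of_nonneg_left hA (by positivity)
        have h2 : p ^ s.choose 2 = p * p ^ (s.choose 2 - 1) := by
          rw [mul_pow_sub_one hc]
        have h3 : t * (4 * Real.log n) < t * (p * (t - 1)) :=
          mul_lt_mul_of_pos_left hB (by linarith)
        push_cast
        rw [h2]
        rw [hb] at h1 ⊢
        nlinarith
    _ ≤ _ := by
        rw [Real.exp_nat_mul]
        exact pow_le_pow_left₀ (Real.exp_pos _).le
          (exp_neg_two_mul_le_one_sub (by positivity) hpc) _

/-- The Ramsey bound `R(s, t) ≥ t ^ ((s + 1) / 2 - o(1))`, for the complementary graph. The edge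
density of the complement, `p = n ^ (-2 / (s + 1)) / 2`, makes the
expected number of `s`-cliques through a given edge of it at most `1 / 4`. -/
theorem eventually_exists_graph {s : ℕ} (hs : 3 ≤ s) {γ : ℝ} (hγ : 2 / ((s : ℝ) + 1) < γ) :
    ∀ᶠ n : ℕ in Filter.atTop, ∃ B : SimpleGraph (Fin n), (∀ S, ¬ B.IsNIndepSet s S) ∧
      ∀ S : Finset (Fin n), B.IsClique (S : Set (Fin n)) → (S.card : ℝ) ≤ 2 * (n : ℝ) ^ γ := by
  set θ : ℝ := 2 / ((s : ℝ) + 1) with hθ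
  have hθ0 : 0 < θ := by positivity
  have hlog : ∀ᶠ n : ℕ in Filter.atTop, ‖Real.log n‖ ≤ 1 / 16 * ‖(n : ℝ) ^ (γ - θ)‖ :=
    tendsto_natCast_atTop_atTop.eventually
      ((isLittleO_log_rpow_atTop (sub_pos.2 hγ)).bound (by norm_num))
  filter_upwards [hlog, Filter.eventually_ge_atTop 1] with n hlog hn
  have hn1 : (1 : ℝ) ≤ n := by exact_mod_cast hn
  have hn0 : (0 : ℝ) < n := by linarith
  have hlog : Real.log n ≤ 1 / 16 * (n : ℝ) ^ (γ - θ) := by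
    rwa [Real.norm_of_nonneg (Real.log_nonneg hn1), Real.norm_of_nonneg (by positivity)] at hlog
  have hγ1 : 1 ≤ (n : ℝ) ^ γ := Real.one_le_rpow hn1 (by linarith)
  set p : ℝ := (n : ℝ) ^ (-θ) / 2 with hp
  have hp0 : 0 < p := by positivity
  have hp1 : p ≤ 1 / 2 := by
    have := Real.rpow_le_one_of_one_le_of_nonpos hn1 (by linarith : -θ ≤ 0)
    linarith
  set t := ⌈(n : ℝ) ^ γ⌉₊ + 1 with ht
  have ht1 : (n : ℝ) ^ γ ≤ (t : ℝ) - 1 := by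
    rw [ht]; push_cast; linarith [Nat.le_ceil ((n : ℝ) ^ γ)]
  have ht2 : 2 ≤ t := by
    have : 0 < ⌈(n : ℝ) ^ γ⌉₊ := Nat.ceil_pos.2 (by linarith)
    omega
  have hA : 4 * (n : ℝ) ^ (s - 2) * p ^ (s.choose 2 - 1) ≤ 1 := by
    have hc3 : 3 ≤ s.choose 2 := Nat.choose_le_choose 2 hs
    have hexp : (s - 2 : ℕ) + -θ * (s.choose 2 - 1 : ℕ) = 0 := by
      rw [Nat.cast_sub (by omega), Nat.cast_sub (by omega), Nat.cast_choose_two, hθ]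
      field_simp
      push_cast
      ring
    have h1 : (n : ℝ) ^ (s - 2) * ((n : ℝ) ^ (-θ)) ^ (s.choose 2 - 1) = 1 := by
      rw [← Real.rpow_natCast, ← Real.rpow_natCast, ← Real.rpow_mul hn0.le, ← Real.rpow_add hn0,
        hexp, Real.rpow_zero]
    have h2 : (2 : ℝ) ^ 2 ≤ 2 ^ (s.choose 2 - 1) := pow_le_pow_right₀ (by norm_num) (by omega)
    rw [hp, div_pow, mul_assoc, ← mul_div_assoc, h1, mul_one_div, div_le_one (by positivity)]
    linarith
  have hB : 4 * Real.log n < p * (t - 1) := by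
    have h1 : p * (n : ℝ) ^ γ = (n : ℝ) ^ (γ - θ) / 2 := by
      rw [hp, div_mul_eq_mul_div, ← Real.rpow_add hn0]; ring_nf
    have h2 : p * (n : ℝ) ^ γ ≤ p * (t - 1) := mul_le_mul_of_nonneg_left ht1 hp0.le
    have h3 : 0 < (n : ℝ) ^ (γ - θ) := by positivity
    linarith
  obtain ⟨B, hB1, hB2⟩ := exists_graph_of_lt (V := Fin n) (s := s) (t := t) (by omega) hp0
    (by linarith) (by simpa using pow_mul_one_sub_pow_lt (by omega) hs ht2 hp0 hp1 hA hB)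
  refine ⟨B, hB1, fun S hS => ?_⟩
  have hcard : S.card < t := by
    by_contra! h
    obtain ⟨T, hTS, hT⟩ := exists_subset_card_eq h
    exact hB2 T ⟨hS.subset (coe_subset.2 hTS), hT⟩
  have h1 : (S.card : ℝ) ≤ ⌈(n : ℝ) ^ γ⌉₊ := by exact_mod_cast Nat.lt_succ_iff.1 hcard
  linarith [Nat.ceil_lt_add_one (by linarith : 0 ≤ (n : ℝ) ^ γ)]

theorem KClawFree.mono {V : Type*} {G : SimpleGraph V} {j k : ℕ} (h : KClawFree G j)
    (hjk : j ≤ k) : KClawFree G k := by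
  intro v S hadj hS
  obtain ⟨T, hTS, hT⟩ := exists_subset_card_eq (hjk.trans_eq hS.card_eq.symm)
  exact h v T (fun u hu => hadj u (hTS hu)) ⟨hS.isIndepSet.mono (coe_subset.2 hTS), hT⟩

/-- `m` linked cones over a graph on about `m ^ ((1 - ε) / ε)` vertices have about `m ^ (1 / ε)`
vertices in total and independence number of order `m`. The exponent `(1 - 2 ε) / (1 - ε)` is what
keeps the cliques below `n ^ (1 - 2 ε)`. -/
theorem exists_graph_le_saIntegralityGap {s : ℕ} (hs : 3 ≤ s) (hs4 : s ≤ 4) {ε : ℝ} (hε : 0 < ε)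
    (hε3 : ε ≤ 1 / 3) (hγ : 2 / ((s : ℝ) + 1) < (1 - 2 * ε) / (1 - ε)) (N₀ : ℕ) :
    ∃ n : ℕ, N₀ ≤ n ∧ ∃ G : SimpleGraph (Fin n), G.Connected ∧ KClawFree G (s + 1) ∧
      1 / 3 * (n : ℝ) ^ ε ≤ (G.indepNum : ℝ) ∧
      ∀ ℓ : ℕ, 1 ≤ ℓ → (ℓ : ℝ) ≤ 1 * (n : ℝ) ^ (1 - 2 * ε) →
        1 / 18 * (n : ℝ) ^ ε ≤ saIntegralityGap G ℓ := by
  set γ := (1 - 2 * ε) / (1 - ε) with hγdef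
  have hγ1 : γ ≤ 1 := (div_le_one (by linarith)).2 (by linarith)
  have hγ0 : 0 ≤ γ := div_nonneg (by linarith) (by linarith)
  set r := (1 - ε) / ε with hr
  have hr0 : 0 < r := div_pos (by linarith) hε
  have htend : Filter.Tendsto (fun m : ℕ => ⌈(m : ℝ) ^ r⌉₊) Filter.atTop Filter.atTop :=
    tendsto_nat_ceil_atTop.comp ((tendsto_rpow_atTop hr0).comp tendsto_natCast_atTop_atTop)
  obtain ⟨m, hB, hmN, hm⟩ := ((htend.eventually (eventually_exists_graph hs hγ)).and
    ((htend.eventually_ge_atTop N₀).and (Filter.eventually_ge_atTop 1))).exists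
  generalize hN : ⌈(m : ℝ) ^ r⌉₊ = N at hB hmN
  obtain ⟨B, hB1, hB2⟩ := hB
  have hm1 : (1 : ℝ) ≤ m := by exact_mod_cast hm
  have hm0 : (0 : ℝ) < m := by linarith
  have hmr : 1 ≤ (m : ℝ) ^ r := Real.one_le_rpow hm1 hr0.le
  have hN1 : (m : ℝ) ^ r ≤ N := hN ▸ Nat.le_ceil _
  have hN2 : (N : ℝ) ≤ 2 * (m : ℝ) ^ r := by
    rw [← hN]
    linarith [Nat.ceil_lt_add_one (by linarith : 0 ≤ (m : ℝ) ^ r)]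
  have hNpos : 0 < N := hN ▸ Nat.ceil_pos.2 (by linarith)
  have : Nonempty (Fin N) := ⟨⟨0, hNpos⟩⟩
  have hindep (S : Finset (Fin N)) (hS : B.IsIndepSet (S : Set (Fin N))) : S.card ≤ s - 1 := by
    by_contra! h
    obtain ⟨T, hTS, hT⟩ := exists_subset_card_eq (show s ≤ S.card by omega)
    exact hB1 T ⟨hS.mono (coe_subset.2 hTS), hT⟩
  have hclique (S : Finset (Fin N)) (hS : B.IsClique (S : Set (Fin N))) :
      S.card ≤ ⌊2 * (N : ℝ) ^ γ⌋₊ := Nat.le_floor (hB2 S hS)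
  set ω := max (⌊2 * (N : ℝ) ^ γ⌋₊ + 1) m with hω
  have hclaw : KClawFree (linkedCones B m) (s + 1) := by
    have := linkedCones_kClawFree (m := m) (by omega) hindep
    rwa [show s - 1 + 2 = s + 1 by omega] at this
  have hα1 := le_indepNum_linkedCones B m
  have hα2 : (linkedCones B m).indepNum ≤ 3 * m := by
    obtain ⟨S, hS⟩ := (linkedCones B m).exists_isNIndepSet_indepNum
    rw [← hS.card_eq, mul_comm]
    exact (card_le_of_isIndepSet_linkedCones (by omega) hindep hS.isIndepSet).trans
      (Nat.mul_le_mul_left m (by omega))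
  obtain ⟨n, hn⟩ : ∃ n, n = Fintype.card (Fin m × Option (Fin N)) := ⟨_, rfl⟩
  obtain ⟨G, hGconn, hGclaw, hGα, hGω⟩ := exists_fin_graph (linkedCones B m) (ω := ω) hn.symm
    (linkedCones_connected B hm) hclaw fun Q hQ => card_le_of_isClique_linkedCones hclique hQ
  rw [← hGα] at hα1 hα2
  have hncard : n = m * (N + 1) := by simp [hn]
  have hncast : (n : ℝ) = m * (N + 1) := by exact_mod_cast hncard
  have hmε : (m : ℝ) * (m : ℝ) ^ r = (m : ℝ) ^ (1 / ε) := by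
    rw [← Real.rpow_one_add' hm0.le (by positivity), hr]
    congr 1
    field_simp
    ring
  have hn1 : (m : ℝ) ^ (1 / ε) ≤ n := by
    rw [hncast, ← hmε]
    exact mul_le_mul_of_nonneg_left (by linarith) hm0.le
  have hn2 : (n : ℝ) ≤ 3 * (m : ℝ) ^ (1 / ε) := by
    rw [hncast, ← hmε, mul_left_comm]
    exact mul_le_mul_of_nonneg_left (by linarith) hm0.le
  have hn0 : (0 : ℝ) < n := lt_of_lt_of_le (by positivity) hn1
  have hn1' : (1 : ℝ) ≤ n := (Real.one_le_rpow hm1 (by positivity)).trans hn1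
  have hnε1 : (m : ℝ) ≤ (n : ℝ) ^ ε := by
    have := Real.rpow_le_rpow (by positivity) hn1 hε.le
    rwa [← Real.rpow_mul hm0.le, one_div_mul_cancel hε.ne', Real.rpow_one] at this
  have hnε2 : (n : ℝ) ^ ε ≤ 3 * m := by
    have h1 := Real.rpow_le_rpow hn0.le hn2 hε.le
    rw [Real.mul_rpow (by norm_num) (by positivity), ← Real.rpow_mul hm0.le,
      one_div_mul_cancel hε.ne', Real.rpow_one] at h1
    have h2 : (3 : ℝ) ^ ε ≤ 3 := Real.rpow_le_self_of_one_le (by norm_num) (by linarith)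
    exact h1.trans (mul_le_mul_of_nonneg_right h2 hm0.le)
  have hNn : (N : ℝ) ≤ 2 * (n : ℝ) ^ (1 - ε) := by
    refine hN2.trans (mul_le_mul_of_nonneg_left ?_ (by norm_num))
    have := Real.rpow_le_rpow (by positivity) hn1 (by linarith : 0 ≤ 1 - ε)
    rwa [← Real.rpow_mul hm0.le, one_div_mul_eq_div] at this
  have hNγ : (N : ℝ) ^ γ ≤ 2 * (n : ℝ) ^ (1 - 2 * ε) := by
    have h1 := Real.rpow_le_rpow (Nat.cast_nonneg N) hNn hγ0
    rw [Real.mul_rpow (by norm_num) (by positivity), ← Real.rpow_mul hn0.le, hγdef,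
      mul_div_cancel₀ _ (by linarith : 1 - ε ≠ 0), ← hγdef] at h1
    have h2 : (2 : ℝ) ^ γ ≤ 2 := Real.rpow_le_self_of_one_le (by norm_num) hγ1
    exact h1.trans (mul_le_mul_of_nonneg_right h2 (by positivity))
  have hn12 : (1 : ℝ) ≤ (n : ℝ) ^ (1 - 2 * ε) := Real.one_le_rpow hn1' (by linarith)
  have hωn : (ω : ℝ) ≤ 5 * (n : ℝ) ^ (1 - 2 * ε) := by
    rw [hω, Nat.cast_max]
    refine max_le ?_ ?_
    · push_cast
      linarith [Nat.floor_le (by positivity : 0 ≤ 2 * (N : ℝ) ^ γ)]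
    · have := Real.rpow_le_rpow_of_exponent_le hn1' (by linarith : ε ≤ 1 - 2 * ε)
      linarith
  have hα1' : (m : ℝ) ≤ G.indepNum := by exact_mod_cast hα1
  have hα2' : (G.indepNum : ℝ) ≤ 3 * m := by exact_mod_cast hα2
  refine ⟨n, ?_, G, hGconn, hGclaw, by linarith, fun ℓ hℓ hℓn => ?_⟩
  · rw [hncard]
    exact hmN.trans ((Nat.le_succ N).trans (Nat.le_mul_of_pos_left _ hm))
  · have hval := card_div_le_saValue hGω hℓ
    rw [Fintype.card_fin] at hval
    rw [saIntegralityGap, le_div_iff₀ (hm0.trans_le hα1')]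
    refine le_trans ?_ hval
    have hℓ1 : (1 : ℝ) ≤ ℓ := by exact_mod_cast hℓ
    rw [le_div_iff₀ (by positivity)]
    calc 1 / 18 * (n : ℝ) ^ ε * G.indepNum * (ℓ + ω)
        ≤ 1 / 18 * (n : ℝ) ^ ε * (3 * (n : ℝ) ^ ε) * (6 * (n : ℝ) ^ (1 - 2 * ε)) := by
          gcongr
          · linarith
          · linarith
      _ = (n : ℝ) ^ ε * (n : ℝ) ^ ε * (n : ℝ) ^ (1 - 2 * ε) := by ring
      _ = n := by
          rw [← Real.rpow_add hn0, ← Real.rpow_add hn0]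
          ring_nf
          exact Real.rpow_one _

theorem theorem4 :
    ∃ c₀ : ℝ, 0 < c₀ ∧ ∀ k : ℕ, 4 ≤ k →
      ∃ c₁ c₂ : ℝ, 0 < c₁ ∧ 0 < c₂ ∧
        ∀ ε : ℝ, 0 < ε → ε ≤ 1 / 3 → (k = 4 → ε < 1 / 3) →
          ∀ N : ℕ, ∃ n : ℕ, N ≤ n ∧ ∃ G : SimpleGraph (Fin n),
            G.Connected ∧ KClawFree G k ∧
            c₀ * (n : ℝ) ^ ε ≤ (G.indepNum : ℝ) ∧
            ∀ ℓ : ℕ, 1 ≤ ℓ → (ℓ : ℝ) ≤ c₁ * (n : ℝ) ^ (1 - 2 * ε) →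
              c₂ * (n : ℝ) ^ ε ≤ saIntegralityGap G ℓ := by
  refine ⟨1 / 3, by norm_num, fun k hk => ⟨1, 1 / 18, by norm_num, by norm_num, ?_⟩⟩
  intro ε hε hε3 hk4 N
  -- `s = 3` would serve every `k` when `ε < 1 / 3`; at the endpoint the exponent is exactly `1 / 2`,
  -- which only `s = 4` allows.
  obtain ⟨s, hs, hs4, hsk, hγ⟩ : ∃ s : ℕ, 3 ≤ s ∧ s ≤ 4 ∧ s + 1 ≤ k ∧
      2 / ((s : ℝ) + 1) < (1 - 2 * ε) / (1 - ε) := by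
    rcases hk.eq_or_lt with rfl | hk5
    · refine ⟨3, le_rfl, by norm_num, le_rfl, ?_⟩
      rw [lt_div_iff₀ (by linarith)]
      push_cast
      linarith [hk4 rfl]
    · refine ⟨4, by norm_num, le_rfl, hk5, ?_⟩
      rw [lt_div_iff₀ (by linarith)]
      push_cast
      linarith
  obtain ⟨n, hn, G, hconn, hclaw, hα, hgap⟩ :=
    exists_graph_le_saIntegralityGap hs hs4 hε hε3 hγ N
  exact ⟨n, hn, G, hconn, hclaw.mono hsk, hα, hgap⟩
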